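/- Let $p$ be a prime, let $\mathbb{C}_p$ be the completion of an algebraic closure of $\mathbb{Q}_p$, $\mathcal{O}_p=\{z\in\mathbb{C}_p : |z|\le 1\}$, and let $k$ be the residue field of $\mathcal{O}_p$. Let $G$ be a subgroup (discrete or not) of $\mathrm{PSL}(2,\mathbb{C}_p)$, acting on $\mathbb{P}^1(\mathbb{C}_p)=\mathbb{C}_p\cup\{\infty\}$ by Möbius maps, where $\mathbb{P}^1(\mathbb{C}_p)$ carries the chordal distance $\rho_v(z,w)=\frac{|z-w|}{\max\{1,|z|\}\max\{1,|w|\}}$, $\rho_v(\infty,w)=\rho_v(w,\infty)=\frac{1}{\max\{1,|w|\}}$ for $z,w\in\mathbb{C}_p$, and $\rho_v(\infty,\infty)=0$. The limit set of $G$ is the set of all $a\in\mathbb{P}^1(\mathbb{C}_p)$ for which there exist $b\in\mathbb{P}^1(\mathbb{C}_p)$ and a sequence $(g_n)_{n\ge 1}$ of pairwise distinct elements of $G$ with $\lim_{n\to\infty} g_n(b)=a$. A map $f\in\mathrm{PSL}(2,\mathbb{C}_p)$ has good reduction if it can be written in homogeneous coordinates as $f([x:y])=[\alpha x+\beta y:\gamma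 x+\delta y]$ with $\alpha,\beta,\gamma,\delta\in\mathcal{O}_p$, at least one of them of absolute value $1$, such that the reductions of the two linear forms have no common zero in $k\times k$ other than $(0,0)$. The group $G$ has potentially good reduction if there is one $h\in\mathrm{PSL}(2,\mathbb{C}_p)$ such that $h^{-1}\circ g\circ h$ has good reduction for every $g\in G$. If the limit set of $G$ is empty, then $G$ has potentially good reduction. -/

import Mathlib

open Filter Topology

namespace PadicMobius

/-- The group `PSL(2, ℂ_p) = SL(2, ℂ_p) / {± I}` (the center of `SL(2, ℂ_p)` is `{± I}`). -/
abbrev PSL2 (p : ℕ) [Fact p.Prime] : Type :=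
  Matrix.ProjectiveSpecialLinearGroup (Fin 2) ℂ_[p]

/-- The projective line `ℙ¹(ℂ_p)`: lines in `ℂ_p²`. The point `z ∈ ℂ_p` is `[z : 1]` and `∞` is
`[1 : 0]`, so that Mathlib's action of `PSL(2, ℂ_p)` is `z ↦ (az + b) / (cz + d)`. -/
abbrev P1 (p : ℕ) [Fact p.Prime] : Type :=
  Projectivization ℂ_[p] (Fin 2 → ℂ_[p])

/-- The chordal distance on `ℙ¹(ℂ_p)` in homogeneous coordinates,
`|x₀ y₁ - x₁ y₀| / (max {|x₀|, |x₁|} max {|y₀|, |y₁|})`; the norm of `Fin 2 → ℂ_[p]` is the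
maximum norm. The lemmas below give its independence of the coordinates and its values on
`ℂ_p ∪ {∞}`. -/
noncomputable def chordalDist {p : ℕ} [Fact p.Prime] (x y : P1 p) : ℝ :=
  ‖x.rep 0 * y.rep 1 - x.rep 1 * y.rep 0‖ / (‖x.rep‖ * ‖y.rep‖)

theorem chordalDist_mk {p : ℕ} [Fact p.Prime] (v w : Fin 2 → ℂ_[p]) (hv : v ≠ 0) (hw : w ≠ 0) :
    chordalDist (Projectivization.mk ℂ_[p] v hv) (Projectivization.mk ℂ_[p] w hw) =
      ‖v 0 * w 1 - v 1 * w 0‖ / (‖v‖ * ‖w‖) := by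
  obtain ⟨a, ha⟩ := Projectivization.exists_smul_eq_mk_rep ℂ_[p] v hv
  obtain ⟨b, hb⟩ := Projectivization.exists_smul_eq_mk_rep ℂ_[p] w hw
  have ha0 : ‖(a : ℂ_[p])‖ ≠ 0 := norm_ne_zero_iff.2 a.ne_zero
  have hb0 : ‖(b : ℂ_[p])‖ ≠ 0 := norm_ne_zero_iff.2 b.ne_zero
  have e : (a • v) 0 * (b • w) 1 - (a • v) 1 * (b • w) 0 =
      ((a : ℂ_[p]) * b) * (v 0 * w 1 - v 1 * w 0) := by
    simp only [Pi.smul_apply, Units.smul_def, smul_eq_mul]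
    ring
  rw [chordalDist, ← ha, ← hb, e, norm_mul, norm_mul, Units.smul_def, Units.smul_def,
    norm_smul, norm_smul]
  have : ‖(a : ℂ_[p])‖ * ‖v‖ * (‖(b : ℂ_[p])‖ * ‖w‖) =
      (‖(a : ℂ_[p])‖ * ‖(b : ℂ_[p])‖) * (‖v‖ * ‖w‖) := by ring
  rw [this, mul_div_mul_left _ _ (mul_ne_zero ha0 hb0)]

/-- The point of `ℙ¹(ℂ_p)` given by `z ∈ ℂ_p`. -/
noncomputable def ofAffine {p : ℕ} [Fact p.Prime] (z : ℂ_[p]) : P1 p :=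
  Projectivization.mk ℂ_[p] ![z, 1] (fun h => one_ne_zero (congrFun h 1))

/-- The point `∞` of `ℙ¹(ℂ_p)`. -/
noncomputable def infinity (p : ℕ) [Fact p.Prime] : P1 p :=
  Projectivization.mk ℂ_[p] ![1, 0] (fun h => one_ne_zero (congrFun h 0))

theorem norm_pair {p : ℕ} [Fact p.Prime] (a b : ℂ_[p]) : ‖![a, b]‖ = max ‖a‖ ‖b‖ := by
  apply le_antisymm
  · refine (pi_norm_le_iff_of_nonneg (le_max_of_le_left (norm_nonneg a))).2 fun i => ?_
    fin_cases i <;> simp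
  · exact max_le (norm_le_pi_norm ![a, b] 0) (norm_le_pi_norm ![a, b] 1)

theorem chordalDist_ofAffine {p : ℕ} [Fact p.Prime] (z w : ℂ_[p]) :
    chordalDist (ofAffine z) (ofAffine w) = ‖z - w‖ / (max 1 ‖z‖ * max 1 ‖w‖) := by
  rw [ofAffine, ofAffine, chordalDist_mk, norm_pair, norm_pair]
  simp [max_comm]

theorem chordalDist_infinity_ofAffine {p : ℕ} [Fact p.Prime] (w : ℂ_[p]) :
    chordalDist (infinity p) (ofAffine w) = 1 / max 1 ‖w‖ := by
  rw [infinity, ofAffine, chordalDist_mk, norm_pair, norm_pair]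
  simp [max_comm]

theorem chordalDist_self {p : ℕ} [Fact p.Prime] (x : P1 p) : chordalDist x x = 0 := by
  simp [chordalDist, mul_comm]

/-- The limit set of `G`: the points `a` for which there are a point `b` and a sequence of pairwise
distinct elements `g₀, g₁, …` of `G` such that `gₙ(b)` tends to `a` in the chordal distance. -/
def limitSet {p : ℕ} [Fact p.Prime] (G : Subgroup (PSL2 p)) : Set (P1 p) :=
  {a | ∃ (b : P1 p) (g : ℕ → PSL2 p), (∀ n, g n ∈ G) ∧ Function.Injective g ∧
    Tendsto (fun n => chordalDist (g n • b) a) atTop (𝓝 0)}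

/-- The rows of `A` are the coefficients of two linear forms over `𝒪_p`, and these give the map `f`
in homogeneous coordinates: `f([x : y]) = [A₀₀ x + A₀₁ y : A₁₀ x + A₁₁ y]` for every point. -/
def IsPresentation {p : ℕ} [Fact p.Prime] (A : Matrix (Fin 2) (Fin 2) 𝓞_ℂ_[p]) (f : PSL2 p) :
    Prop :=
  ∀ (v : Fin 2 → ℂ_[p]) (hv : v ≠ 0),
    ∃ hA : (A.map (fun a => (a : ℂ_[p]))).mulVec v ≠ 0,
      f • Projectivization.mk ℂ_[p] v hv =
        Projectivization.mk ℂ_[p] ((A.map (fun a => (a : ℂ_[p]))).mulVec v) hA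

/-- Good reduction of a Möbius map (a rational map of degree one): it has a presentation by two
linear forms over `𝒪_p`, at least one coefficient having absolute value `1`, whose reductions have
no common zero in `k × k` but `(0, 0)`, where `k` is the residue field. -/
def HasGoodReduction {p : ℕ} [Fact p.Prime] (f : PSL2 p) : Prop :=
  ∃ A : Matrix (Fin 2) (Fin 2) 𝓞_ℂ_[p],
    IsPresentation A f ∧ (∃ i j, ‖(A i j : ℂ_[p])‖ = 1) ∧
    ∀ v : Fin 2 → IsLocalRing.ResidueField 𝓞_ℂ_[p],
      (A.map (IsLocalRing.residue 𝓞_ℂ_[p])).mulVec v = 0 → v = 0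

/-- A subgroup has potentially good reduction if a single conjugation makes all of its elements
have good reduction. -/
def HasPotentiallyGoodReduction {p : ℕ} [Fact p.Prime] (G : Subgroup (PSL2 p)) : Prop :=
  ∃ h : PSL2 p, ∀ g ∈ G, HasGoodReduction (h⁻¹ * g * h)

end PadicMobius

namespace PadicMobius

open Matrix MulAction

/-! An empty limit set makes `G` finite. Infinitely many elements fixing `b` would make `b` a limit
point, so point stabilizers are finite; every Möbius map over ℂ_p has a fixed point, so `G` is a
torsion group. A nontrivial element of finite order is diagonalizable and fixes exactly two points
(`ncard_fixedBy_eq_two`), and a finitely generated torsion linear group is finite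
(`finite_closure_of_isOfFinOrder_psl`). Klein's orbit count shows that a finite subgroup of order
above 60 has a point stabilizer of index at most 2. If `G` were infinite, ever larger finite
subgroups would produce arbitrarily large stabilizers at points of one finite set, which is
impossible (`finite_of_locallyFinite_of_fixedBy`). A finite group preserves a lattice, and in a
basis of it all matrices are integral of determinant one, hence of good reduction. -/

/-! ### Orbit counting for groups whose nontrivial elements fix two points -/

/-- The points of `X` that are fixed by a nontrivial element of `F`. -/
def nonfreePoints (F X : Type*) [Group F] [MulAction F X] : SubMulAction F X where
  carrier := {x | ∃ g : F, g ≠ 1 ∧ g • x = x}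
  smul_mem' := by
    rintro c x ⟨g, hg, hx⟩
    refine ⟨c * g * c⁻¹, by simpa using hg, ?_⟩
    simp [mul_smul, hx]

/-- Dividing by `N` gives `1/k + 1/l + 1/m = 1 + 2/N`. If `c ≥ 3`, only `(2,3,3)`, `(2,3,4)` and
`(2,3,5)` remain, with `N = 12, 24, 60`: the polyhedral groups. This is the origin of the bound 60.
-/
theorem sum_orbit_arithmetic {N a b c k l m : ℕ} (hN : 60 < N) (ha : a * k = N) (hb : b * l = N)
    (hc : c * m = N) (hk : 2 ≤ k) (hl : 2 ≤ l) (hab : b ≤ a) (hbc : c ≤ b)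
    (h : a + b + c = N + 2) : c ≤ 2 := by
  by_contra! h3
  have hk2 : k = 2 := by
    by_contra hk2
    have : 3 ≤ k := by omega
    nlinarith
  subst hk2
  have hl3 : 3 ≤ l := by
    by_contra hl3
    have : l = 2 := by omega
    subst this
    omega
  have hl4 : l < 4 := by
    by_contra! hl4
    nlinarith
  have : l = 3 := by omega
  subst this
  have hm : m < 6 := by
    by_contra! hm
    nlinarith
  interval_cases m <;> omega

theorem exists_card_le_two_mul_card_stabilizer {F X : Type*} [Group F] [MulAction F X] [Finite F]
    (hfix : ∀ g : F, g ≠ 1 → (fixedBy X g).ncard = 2) (hF : 60 < Nat.card F) :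
    ∃ x : X, Nat.card F ≤ 2 * Nat.card (stabilizer F x) := by
  classical
  by_contra! hcon
  let Y := nonfreePoints F X
  have hYfin : Finite Y := by
    have : (Y : Set X) ⊆ ⋃ g : {g : F // g ≠ 1}, fixedBy X g.1 := by
      rintro x ⟨g, hg, hx⟩
      exact Set.mem_iUnion.2 ⟨⟨g, hg⟩, hx⟩
    refine Set.Finite.subset (Set.finite_iUnion fun g => ?_) this
    exact Set.finite_of_ncard_ne_zero (by rw [hfix g.1 g.2]; norm_num)
  have := Fintype.ofFinite Y
  have := Fintype.ofFinite F
  let Ω := Quotient (orbitRel F Y)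
  have hΩ : Fintype Ω := Fintype.ofFinite Ω
  have hfixY : ∀ g : F, g ≠ 1 → Fintype.card (fixedBy Y g) = 2 := by
    intro g hg
    rw [← hfix g hg, ← Nat.card_coe_set_eq, ← Nat.card_eq_fintype_card]
    refine Nat.card_congr ⟨fun y => ⟨y.1.1, congrArg Subtype.val y.2⟩,
      fun x => ⟨⟨x.1, g, hg, x.2⟩, Subtype.ext x.2⟩, fun _ => rfl, fun _ => rfl⟩
  -- Burnside's formula, with the identity split off: `|Y| + 2(|F| - 1) = r|F|` for `r` orbits.
  have hburn := sum_card_fixedBy_eq_card_orbits_mul_card_group F Y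
  rw [← Finset.add_sum_erase _ _ (Finset.mem_univ (1 : F)),
    Finset.sum_congr rfl (fun g hg => hfixY g (Finset.ne_of_mem_erase hg)), Finset.sum_const,
    Finset.card_erase_of_mem (Finset.mem_univ _), Finset.card_univ, smul_eq_mul] at hburn
  have hone : Fintype.card (fixedBy Y (1 : F)) = Fintype.card Y := by
    rw [← Nat.card_eq_fintype_card, ← Nat.card_eq_fintype_card, fixedBy_one_eq_univ]
    exact Nat.card_congr (Equiv.Set.univ Y)
  rw [hone] at hburn
  let s : Ω → ℕ := fun ω => Fintype.card (orbit F ω.out)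
  let n : Ω → ℕ := fun ω => Fintype.card (stabilizer F ω.out)
  have hsn : ∀ ω, s ω * n ω = Fintype.card F := fun ω =>
    card_orbit_mul_card_stabilizer_eq_card_group F ω.out
  have hY : Fintype.card Y = ∑ ω, s ω := by
    rw [Fintype.card_congr (selfEquivSigmaOrbits F Y), Fintype.card_sigma]
  rw [Nat.card_eq_fintype_card] at hF
  have hn : ∀ ω, 2 ≤ n ω := by
    intro ω
    obtain ⟨g, hg, hx⟩ := (ω.out : Y).2
    exact Fintype.one_lt_card_iff.2 ⟨⟨g, Subtype.ext hx⟩, 1, fun h => hg (congrArg Subtype.val h)⟩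
  have hs3 : ∀ ω, 3 ≤ s ω := by
    intro ω
    have h1 := hcon (ω.out : Y).1
    have h2 : Nat.card (stabilizer F (ω.out : Y).1) = n ω := by
      simp only [n, ← Nat.card_eq_fintype_card]
      congr 2
      ext g
      simp [mem_stabilizer_iff, Subtype.ext_iff]
    rw [h2, Nat.card_eq_fintype_card, ← hsn ω] at h1
    by_contra! h3
    have : s ω ≤ 2 := by omega
    nlinarith [hn ω]
  have hs2 : ∀ ω, 2 * s ω ≤ Fintype.card F := by
    intro ω
    rw [← hsn ω, mul_comm]
    exact Nat.mul_le_mul_left _ (hn ω)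
  rw [hY] at hburn
  have hle : 2 * ∑ ω, s ω ≤ Fintype.card Ω * Fintype.card F := by
    rw [Finset.mul_sum, ← smul_eq_mul, ← Finset.card_univ]
    exact Finset.sum_le_card_nsmul _ _ _ fun ω _ => hs2 ω
  have hge : Fintype.card Ω * 3 ≤ ∑ ω, s ω := by
    rw [← smul_eq_mul, ← Finset.card_univ]
    exact Finset.card_nsmul_le_sum _ _ _ fun ω _ => hs3 ω
  change _ = Fintype.card Ω * Fintype.card F at hburn
  -- Orbit sizes lie between 3 and `|F|/2`; with Burnside's formula this leaves only three orbits.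
  have hr : Fintype.card Ω < 4 := by
    by_contra! hr
    have := Nat.mul_le_mul_right (Fintype.card F) hr
    omega
  have hr3 : Fintype.card Ω = 3 := by
    interval_cases h : Fintype.card Ω <;> omega
  obtain ⟨e⟩ : Nonempty (Ω ≃ Fin 3) := ⟨Fintype.equivFinOfCardEq hr3⟩
  rw [← e.symm.sum_comp, Fin.sum_univ_three, hr3] at hburn
  have hsum : s (e.symm 0) + s (e.symm 1) + s (e.symm 2) = Fintype.card F + 2 := by omega
  generalize e.symm 0 = x at hsum
  generalize e.symm 1 = y at hsum
  generalize e.symm 2 = z at hsum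
  have key : ∀ x y z, s y ≤ s x → s z ≤ s y → s x + s y + s z = Fintype.card F + 2 → False :=
    fun x y z h1 h2 h => by
      have := sum_orbit_arithmetic hF (hsn x) (hsn y) (hsn z) (hn x) (hn y) h1 h2 h
      have := hs3 z
      omega
  rcases le_total (s x) (s y) with h1 | h1 <;> rcases le_total (s y) (s z) with h2 | h2 <;>
    rcases le_total (s x) (s z) with h3 | h3
  · exact key z y x h2 h1 (by omega)
  · exact key z y x h2 h1 (by omega)
  · exact key y z x h2 h3 (by omega)
  · exact key y x z h1 h3 (by omega)
  · exact key z x y h3 h1 (by omega)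
  · exact key x z y h3 h2 (by omega)
  · exact key x y z h1 h2 (by omega)
  · exact key x y z h1 h2 (by omega)

/-- A locally finite group that acts with finite stabilizers, every nontrivial element having
exactly two fixed points, is finite. -/
theorem finite_of_locallyFinite_of_fixedBy {G X : Type*} [Group G] [MulAction G X]
    (hfix : ∀ g : G, g ≠ 1 → (fixedBy X g).ncard = 2) (hstab : ∀ x : X, Finite (stabilizer G x))
    (hloc : ∀ S : Set G, S.Finite → Finite (Subgroup.closure S)) : Finite G := by
  by_contra hinf
  have : Infinite G := not_finite_iff_infinite.1 hinf
  have hbig : ∀ F : Subgroup G, Finite F → ∀ m : ℕ, ∃ F' : Subgroup G, F ≤ F' ∧ Finite F' ∧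
      m < Nat.card F' := by
    intro F hF m
    obtain ⟨T, hT⟩ := Infinite.exists_subset_card_eq G (m + 1)
    have hfin := hloc (F ∪ T : Set G) (Set.Finite.union hF T.finite_toSet)
    refine ⟨_, fun g hg => Subgroup.subset_closure (Or.inl hg), hfin, ?_⟩
    have h1 : (T : Set G) ⊆ (Subgroup.closure (F ∪ T : Set G) : Set G) :=
      fun g hg => Subgroup.subset_closure (Or.inr hg)
    have h2 := Set.ncard_le_ncard h1 hfin
    rw [Set.ncard_coe_finset, hT] at h2
    exact h2
  have hstabF : ∀ F : Subgroup G, Finite F → 60 < Nat.card F →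
      ∃ x : X, Nat.card F ≤ 2 * Nat.card (stabilizer F x) := fun F hF h =>
    exists_card_le_two_mul_card_stabilizer
      (fun g hg => hfix g.1 fun h => hg (Subtype.ext h)) h
  -- `M` bounds the stabilizers at the finitely many points fixed by nontrivial elements of `F₁`.
  -- The order of `F` must exceed 60 for the orbit count and `2 * M` for the contradiction.
  obtain ⟨F₁, -, hF₁, hcard₁⟩ := hbig ⊥ inferInstance 60
  let Y : Set X := ⋃ g : {g : F₁ // g ≠ 1}, fixedBy X (g.1 : G)
  have hY : Y.Finite := Set.finite_iUnion fun g => Set.finite_of_ncard_ne_zero (by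
    rw [hfix _ fun h => g.2 (Subtype.ext h)]; norm_num)
  obtain ⟨M, hM⟩ := (hY.image fun x => Nat.card (stabilizer G x)).bddAbove
  obtain ⟨F, hle, hF, hcard⟩ := hbig F₁ hF₁ (2 * M + 60)
  obtain ⟨x, hx⟩ := hstabF F hF (by omega)
  have hFx : Nat.card (stabilizer F x) ≤ Nat.card (stabilizer G x) :=
    Nat.card_le_card_of_injective
      (fun g : stabilizer F x => (⟨g.1.1, g.2⟩ : stabilizer G x))
      fun a b h => Subtype.ext (Subtype.ext (congrArg (fun t => t.1) h))
  -- Otherwise `F₁`, of order above 60, would embed in the coset space of a stabilizer of index at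
  -- most 2.
  have hxY : x ∈ Y := by
    by_contra hxY
    have htriv : ∀ g ∈ F₁, g • x = x → g = 1 := by
      intro g hg hgx
      by_contra hg1
      exact hxY (Set.mem_iUnion.2 ⟨⟨⟨g, hg⟩, fun h => hg1 (congrArg Subtype.val h)⟩, hgx⟩)
    have hinj : Function.Injective (fun g : F₁ => ((⟨g.1, hle g.2⟩ : F) : F ⧸ stabilizer F x)) := by
      intro a b hab
      have h1 : (⟨a.1, hle a.2⟩ : F)⁻¹ * ⟨b.1, hle b.2⟩ ∈ stabilizer F x := QuotientGroup.eq.1 hab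
      have h2 := htriv (a.1⁻¹ * b.1) (F₁.mul_mem (F₁.inv_mem a.2) b.2) h1
      exact Subtype.ext (inv_mul_eq_one.1 h2)
    have h1 := Nat.card_le_card_of_injective _ hinj
    have h2 := Subgroup.card_eq_card_quotient_mul_card_subgroup (stabilizer F x)
    have h3 : 0 < Nat.card (stabilizer F x) := Nat.card_pos
    nlinarith
  have : Nat.card (stabilizer G x) ≤ M := hM (Set.mem_image_of_mem _ hxY)
  omega

/-! ### Finitely generated torsion linear groups in characteristic zero -/

theorem isJacobsonRing_int : IsJacobsonRing ℤ := by
  rw [isJacobsonRing_iff_prime_eq]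
  intro P hP
  by_cases h : P = ⊥
  · subst h
    rw [eq_bot_iff]
    intro x hx
    -- For `x` in the Jacobson radical, `x * x + 1` is a unit of ℤ, so `x = 0`.
    have := Int.isUnit_iff.1 (Ideal.mem_jacobson_bot.1 hx x)
    rw [Ideal.mem_bot]
    nlinarith [this.elim (fun h => h.le) (fun h => by omega)]
  · have := hP.isMaximal h
    exact Ideal.jacobson_eq_self_of_isMaximal

/-- By the Nullstellensatz over ℤ the residue field is a finite ℤ-module; in characteristic zero it
would be integral over ℤ, making ℤ a field. -/
theorem finite_quotient_of_finiteType_int {A : Type*} [CommRing A] [Algebra.FiniteType ℤ A]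
    (m : Ideal A) [m.IsMaximal] : Finite (A ⧸ m) := by
  let := Ideal.Quotient.field m
  have := isJacobsonRing_int
  have hfin : Module.Finite ℤ (A ⧸ m) := finite_of_finite_type_of_isJacobsonRing ℤ (A ⧸ m)
  obtain ⟨q, hq⟩ := CharP.exists (A ⧸ m)
  have hq0 : q ≠ 0 := by
    rintro rfl
    have : CharZero (A ⧸ m) := CharP.charP_to_charZero _
    exact Int.not_isField (isField_of_isIntegral_of_isField
      (R := ℤ) (S := A ⧸ m) (RingHom.injective_int _) (Field.toIsField _))
  have : NeZero q := ⟨hq0⟩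
  let := ZMod.algebra (A ⧸ m) q
  have : Module.Finite (ZMod q) (A ⧸ m) := Module.Finite.of_restrictScalars_finite ℤ (ZMod q) (A ⧸ m)
  exact Module.finite_of_finite (ZMod q)

/-- A matrix over a domain that is congruent to `1` and of prime order `q` is trivial if `q` is not
zero in the residue field. -/
theorem eq_one_of_pow_eq_one_of_map_eq_one {n R k : Type*} [Fintype n] [DecidableEq n] [CommRing R]
    [IsDomain R] [Field k] (φ : R →+* k) {q : ℕ} (hq : (q : k) ≠ 0) {M : Matrix n n R}
    (hM : M.map φ = 1) (hpow : M ^ q = 1) : M = 1 := by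
  -- `U * (M - 1) = M ^ q - 1 = 0`, while `U` reduces to `q` times the identity, so `det U ≠ 0` and
  -- the adjugate of `U` cancels it.
  let U : Matrix n n R := ∑ i ∈ Finset.range q, M ^ i
  have hU : U * (M - 1) = 0 := by
    rw [geom_sum_mul, hpow, sub_self]
  have hUφ : φ.mapMatrix U = (q : k) • (1 : Matrix n n k) := by
    have : φ.mapMatrix M = 1 := hM
    simp [U, map_sum, map_pow, this, Nat.cast_smul_eq_nsmul]
  have hdet : U.det ≠ 0 := by
    intro h
    have h1 := φ.map_det U
    rw [h, hUφ, Matrix.det_smul, map_zero, Matrix.det_one, mul_one] at h1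
    exact pow_ne_zero _ hq h1.symm
  have h2 : U.det • (M - 1) = 0 := by
    rw [← one_mul (M - 1), ← Matrix.smul_mul, ← Matrix.adjugate_mul, Matrix.mul_assoc, hU,
      Matrix.mul_zero]
  exact sub_eq_zero.1 ((smul_eq_zero.1 h2).resolve_left hdet)

/-- The matrices of determinant one with coefficients in a subring. -/
def integralSL {n K : Type*} [Fintype n] [DecidableEq n] [Field K] (A : Subalgebra ℤ K) :
    Subgroup (Matrix.SpecialLinearGroup n K) :=
  (Matrix.SpecialLinearGroup.map (n := n) (algebraMap A K)).range

theorem mem_integralSL {n K : Type*} [Fintype n] [DecidableEq n] [Field K] {A : Subalgebra ℤ K}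
    {g : Matrix.SpecialLinearGroup n K} (hg : ∀ i j, g i j ∈ A) : g ∈ integralSL A := by
  refine ⟨⟨Matrix.of fun i j => ⟨g i j, hg i j⟩, ?_⟩, ?_⟩
  · apply (FaithfulSMul.algebraMap_injective A K)
    rw [RingHom.map_det, map_one]
    exact g.2
  · ext i j
    rfl

/-- `H` is the congruence subgroup of a maximal ideal with finite residue field of characteristic
`l`. That `l` is not a unit of `A` serves to obtain a different prime from a larger ring. -/
theorem exists_finiteIndex_integralSL {n K : Type*} [Fintype n] [DecidableEq n] [Field K]
    (A : Subalgebra ℤ K) [Algebra.FiniteType ℤ A] :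
    ∃ l : ℕ, l.Prime ∧ (∀ a ∈ A, (l : K) * a ≠ 1) ∧ ∃ H : Subgroup (Matrix.SpecialLinearGroup n K),
      H.relIndex (integralSL A) ≠ 0 ∧
      ∀ g ∈ H, ∀ q : ℕ, q.Prime → g ^ q = 1 → g = 1 ∨ q = l := by
  obtain ⟨m, hm⟩ := Ideal.exists_maximal A
  let := Ideal.Quotient.field m
  have hfin := finite_quotient_of_finiteType_int m
  obtain ⟨l, hl⟩ := CharP.exists (A ⧸ m)
  have hlp : l.Prime := (CharP.char_is_prime_or_zero (A ⧸ m) l).resolve_right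
    (CharP.char_ne_zero_of_finite (A ⧸ m) l)
  have hinj : Function.Injective (Matrix.SpecialLinearGroup.map (n := n) (algebraMap A K)) := by
    intro a b hab
    ext i j
    exact congrArg (fun M : Matrix.SpecialLinearGroup n K => M i j) hab
  let f := Matrix.SpecialLinearGroup.map (n := n) (Ideal.Quotient.mk m)
  refine ⟨l, hlp, ?_, f.ker.map (Matrix.SpecialLinearGroup.map (algebraMap A K)), ?_, ?_⟩
  · intro a ha h
    have h1 : (l : A) * ⟨a, ha⟩ = 1 := Subtype.ext (by simpa using h)
    have h2 := congrArg (Ideal.Quotient.mk m) h1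
    rw [map_mul, map_natCast, CharP.cast_eq_zero, zero_mul, map_one] at h2
    exact zero_ne_one h2
  · rw [integralSL, MonoidHom.range_eq_map, Subgroup.relIndex_map_map_of_injective _ _ hinj,
      Subgroup.relIndex_top_right]
    have : Finite (Matrix.SpecialLinearGroup n (A ⧸ m)) := Subtype.finite
    exact Subgroup.FiniteIndex.index_ne_zero
  · rintro _ ⟨g, hg, rfl⟩ q hq hpow
    by_contra! hcon
    obtain ⟨hg1, hql⟩ := hcon
    have hpow' : g ^ q = 1 := hinj (by rw [map_pow, hpow, map_one])
    have hq0 : (q : A ⧸ m) ≠ 0 := by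
      rw [Ne, CharP.cast_eq_zero_iff (A ⧸ m) l]
      intro h
      exact hql ((Nat.prime_dvd_prime_iff_eq hlp hq).1 h).symm
    apply hg1
    have : g = 1 := Subtype.ext (eq_one_of_pow_eq_one_of_map_eq_one (Ideal.Quotient.mk m) hq0
      (congrArg Subtype.val (show f g = 1 from hg)) (by
        rw [← Matrix.SpecialLinearGroup.coe_pow, hpow']; rfl))
    rw [this, map_one]

/-- A finitely generated torsion subgroup of `SL(n, K)` is finite if `K` has characteristic zero. -/
theorem finite_closure_of_isOfFinOrder {n K : Type*} [Fintype n] [DecidableEq n] [Field K]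
    [CharZero K] {S : Set (Matrix.SpecialLinearGroup n K)} (hS : S.Finite)
    (htor : ∀ g ∈ Subgroup.closure S, IsOfFinOrder g) : Finite (Subgroup.closure S) := by
  let E : Set K := ⋃ g ∈ S, Set.range fun ij : n × n => g ij.1 ij.2
  have hE : E.Finite := hS.biUnion fun g _ => Set.finite_range _
  have hmem : ∀ T : Set K, E ⊆ T → Subgroup.closure S ≤ integralSL (Algebra.adjoin ℤ T) := by
    intro T hT
    rw [Subgroup.closure_le]
    intro g hg
    exact mem_integralSL fun i j =>
      Algebra.subset_adjoin (hT (Set.mem_biUnion hg ⟨(i, j), rfl⟩))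
  have : Algebra.FiniteType ℤ (Algebra.adjoin ℤ E) := .adjoin_of_finite hE
  obtain ⟨l, hl, -, H, hH, hHq⟩ := exists_finiteIndex_integralSL (n := n) (Algebra.adjoin ℤ E)
  -- Inverting `l` forces the second residue characteristic to differ from `l`.
  have : Algebra.FiniteType ℤ (Algebra.adjoin ℤ (insert (l : K)⁻¹ E)) :=
    .adjoin_of_finite (hE.insert _)
  obtain ⟨l', -, hl', H', hH', hHq'⟩ :=
    exists_finiteIndex_integralSL (n := n) (Algebra.adjoin ℤ (insert (l : K)⁻¹ E))
  have hne : l ≠ l' := by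
    rintro rfl
    exact hl' _ (Algebra.subset_adjoin (Set.mem_insert _ _))
      (mul_inv_cancel₀ (Nat.cast_ne_zero.2 hl.ne_zero))
  have h1 : (H ⊓ H').relIndex (Subgroup.closure S) ≠ 0 :=
    Subgroup.relIndex_inf_ne_zero
      (mt (Subgroup.relIndex_eq_zero_of_le_right (hmem _ subset_rfl)) hH)
      (mt (Subgroup.relIndex_eq_zero_of_le_right (hmem _ (Set.subset_insert _ _))) hH')
  -- A nontrivial torsion element has a power of prime order, which would equal both `l` and `l'`.
  have hbot : (H ⊓ H') ⊓ Subgroup.closure S = ⊥ := by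
    rw [Subgroup.eq_bot_iff_forall]
    rintro g ⟨⟨hgH, hgH'⟩, hgS⟩
    by_contra hg
    have hord : orderOf g ≠ 1 := mt orderOf_eq_one_iff.1 hg
    obtain ⟨q, hq, hqd⟩ := Nat.exists_prime_and_dvd hord
    have hpos := (htor g hgS).orderOf_pos
    have hx : orderOf (g ^ (orderOf g / q)) = q := orderOf_pow_orderOf_div hpos.ne' hqd
    have hxq : (g ^ (orderOf g / q)) ^ q = 1 := by
      rw [← pow_mul, Nat.div_mul_cancel hqd, pow_orderOf_eq_one]
    have hx1 : g ^ (orderOf g / q) ≠ 1 := by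
      intro h
      rw [h, orderOf_one] at hx
      exact hq.one_lt.ne hx
    have e1 := (hHq _ (H.pow_mem hgH _) q hq hxq).resolve_left hx1
    have e2 := (hHq' _ (H'.pow_mem hgH' _) q hq hxq).resolve_left hx1
    exact hne (e1.symm.trans e2)
  rw [← Subgroup.inf_relIndex_right, hbot, Subgroup.relIndex_bot_left] at h1
  exact Nat.finite_of_card_ne_zero h1

/-! ### Fixed points of Möbius maps -/

section FixedPoints

variable {K : Type*} [Field K]

theorem mk_eq_mk_iff_cross {v w : Fin 2 → K} (hv : v ≠ 0) (hw : w ≠ 0) :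
    Projectivization.mk K v hv = Projectivization.mk K w hw ↔ v 0 * w 1 = v 1 * w 0 := by
  rw [Projectivization.mk_eq_mk_iff']
  constructor
  · rintro ⟨a, rfl⟩
    simp only [Pi.smul_apply, smul_eq_mul]
    ring
  · intro h
    by_cases h0 : w 0 = 0
    · have h1 : w 1 ≠ 0 := fun h1 => hw (by ext i; fin_cases i <;> assumption)
      refine ⟨v 1 / w 1, ?_⟩
      have hv0 : v 0 = 0 := by simpa [h0, h1] using h
      ext i
      fin_cases i
      · simp [h0, hv0]
      · simp [h1]
    · refine ⟨v 0 / w 0, ?_⟩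
      ext i
      fin_cases i
      · simp [h0]
      · simp only [Pi.smul_apply, smul_eq_mul, Fin.mk_one]
        rw [div_mul_eq_mul_div, h, mul_div_assoc, div_self h0, mul_one]

theorem psl_smul_mk_eq_iff (A : Matrix.SpecialLinearGroup (Fin 2) K) {v w : Fin 2 → K} (hv : v ≠ 0)
    (hw : w ≠ 0) :
    (A : ProjectiveSpecialLinearGroup (Fin 2) K) • Projectivization.mk K v hv =
      Projectivization.mk K w hw ↔ ∃ a : K, a • w = A.1 *ᵥ v := by
  rw [ProjectiveSpecialLinearGroup.smul_proj_mk, Projectivization.smul_mk,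
    Projectivization.mk_eq_mk_iff']
  rfl

theorem det_eq_one_fin_two (A : Matrix.SpecialLinearGroup (Fin 2) K) :
    A.1 0 0 * A.1 1 1 - A.1 0 1 * A.1 1 0 = 1 := by
  rw [← det_fin_two, A.2]

theorem coe_eq_one_of_eq_smul_one {A : Matrix.SpecialLinearGroup (Fin 2) K} {r : K}
    (h : A.1 = r • (1 : Matrix (Fin 2) (Fin 2) K)) :
    (A : ProjectiveSpecialLinearGroup (Fin 2) K) = 1 := by
  rw [QuotientGroup.eq_one_iff, Matrix.SpecialLinearGroup.mem_center_iff]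
  refine ⟨r, ?_, by rw [h, smul_one_eq_diagonal]; rfl⟩
  have := A.2
  rwa [h, det_smul, det_one, mul_one] at this

theorem isOfFinOrder_of_coe {n : Type*} [Fintype n] [DecidableEq n] [Nonempty n]
    {A : Matrix.SpecialLinearGroup n K}
    (h : IsOfFinOrder (A : ProjectiveSpecialLinearGroup n K)) : IsOfFinOrder A := by
  obtain ⟨m, hm, hA⟩ := isOfFinOrder_iff_pow_eq_one.1 h
  rw [← QuotientGroup.mk_pow, QuotientGroup.eq_one_iff, Matrix.SpecialLinearGroup.mem_center_iff] at hA
  obtain ⟨r, hr, hrA⟩ := hA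
  refine isOfFinOrder_iff_pow_eq_one.2 ⟨m * Fintype.card n, Nat.mul_pos hm Fintype.card_pos, ?_⟩
  apply Subtype.ext
  rw [pow_mul, Matrix.SpecialLinearGroup.coe_pow, ← hrA, ← map_pow, hr, map_one]
  rfl

/-- By Cayley–Hamilton `(A - μ)(A - ν) = 0`, so any nonzero column of `A - ν` serves; one exists
because `A` is not scalar. -/
theorem exists_eigenvector {A : Matrix.SpecialLinearGroup (Fin 2) K} {μ ν : K}
    (hsum : μ + ν = A.1 0 0 + A.1 1 1) (hprod : μ * ν = 1)
    (hA : (A : ProjectiveSpecialLinearGroup (Fin 2) K) ≠ 1) :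
    ∃ v : Fin 2 → K, v ≠ 0 ∧ A.1 *ᵥ v = μ • v := by
  have hdet := det_eq_one_fin_two A
  have hmul : A.1 * (A.1 - ν • 1) = μ • (A.1 - ν • (1 : Matrix (Fin 2) (Fin 2) K)) := by
    have hμ : μ = A.1 0 0 + A.1 1 1 - ν := by rw [← hsum]; ring
    subst hμ
    ext i j
    fin_cases i <;> fin_cases j <;> simp [Matrix.mul_apply, Fin.sum_univ_two] <;> grind
  have hne : A.1 - ν • (1 : Matrix (Fin 2) (Fin 2) K) ≠ 0 := fun h =>
    hA (coe_eq_one_of_eq_smul_one (sub_eq_zero.1 h))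
  obtain ⟨j, hj⟩ : ∃ j, (A.1 - ν • (1 : Matrix (Fin 2) (Fin 2) K)).col j ≠ 0 := by
    by_contra! h
    exact hne (by ext i j; exact congrFun (h j) i)
  refine ⟨_, hj, ?_⟩
  ext i
  have := congrFun (congrFun hmul i) j
  simpa [Matrix.mul_apply, mulVec, dotProduct] using this

theorem exists_eigenvalues [IsAlgClosed K] [CharZero K] (A : Matrix.SpecialLinearGroup (Fin 2) K) :
    ∃ μ ν : K, μ + ν = A.1 0 0 + A.1 1 1 ∧ μ * ν = 1 := by
  obtain ⟨s, hs⟩ := IsAlgClosed.exists_pow_nat_eq ((A.1 0 0 + A.1 1 1) ^ 2 - 4) (n := 2) two_pos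
  refine ⟨(A.1 0 0 + A.1 1 1 + s) / 2, (A.1 0 0 + A.1 1 1 - s) / 2, by ring, ?_⟩
  linear_combination -hs / 4

theorem exists_smul_eq_self [IsAlgClosed K] [CharZero K]
    (g : ProjectiveSpecialLinearGroup (Fin 2) K) :
    ∃ x : Projectivization K (Fin 2 → K), g • x = x := by
  by_cases hg : g = 1
  · exact ⟨Projectivization.mk K ![1, 0] (fun h => one_ne_zero (congrFun h 0)), by rw [hg, one_smul]⟩
  · obtain ⟨A, rfl⟩ := QuotientGroup.mk_surjective g
    obtain ⟨μ, ν, hsum, hprod⟩ := exists_eigenvalues A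
    obtain ⟨v, hv, hAv⟩ := exists_eigenvector hsum hprod hg
    exact ⟨Projectivization.mk K v hv, (psl_smul_mk_eq_iff A hv hv).2 ⟨μ, hAv.symm⟩⟩

/-- If `μ = ν`, then `N = A - μ` squares to zero and `A ^ m = μ ^ m + m μ ^ (m - 1) N`. In
characteristic zero, `A ^ m = 1` makes `N`, hence `A`, scalar. -/
theorem eigenvalues_ne [CharZero K] {A : Matrix.SpecialLinearGroup (Fin 2) K} (hfin : IsOfFinOrder A)
    (hA : (A : ProjectiveSpecialLinearGroup (Fin 2) K) ≠ 1) {μ ν : K}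
    (hsum : μ + ν = A.1 0 0 + A.1 1 1) (hprod : μ * ν = 1) : μ ≠ ν := by
  rintro rfl
  have hdet := det_eq_one_fin_two A
  have hμ : μ ≠ 0 := left_ne_zero_of_mul_eq_one hprod
  let N : Matrix (Fin 2) (Fin 2) K := A.1 - μ • 1
  have hN : N * N = 0 := by
    ext i j
    fin_cases i <;> fin_cases j <;> simp [N, Matrix.mul_apply, Fin.sum_univ_two] <;> grind
  have hAN : A.1 = μ • 1 + N := by simp [N]
  have hpow : ∀ m : ℕ, A.1 ^ (m + 1) = μ ^ (m + 1) • 1 + ((m + 1 : ℕ) * μ ^ m) • N := by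
    intro m
    induction m with
    | zero => simp [hAN]
    | succ m ih =>
      rw [pow_succ, ih, hAN]
      simp only [add_mul, mul_add, smul_mul_assoc, mul_smul_comm, one_mul, mul_one, hN, smul_zero,
        add_zero]
      push_cast
      module
  obtain ⟨m, hm, hm1⟩ := isOfFinOrder_iff_pow_eq_one.1 hfin
  obtain ⟨m, rfl⟩ := Nat.exists_eq_succ_of_ne_zero hm.ne'
  have h1 : A.1 ^ (m + 1) = 1 :=
    (Matrix.SpecialLinearGroup.coe_pow A _).symm.trans (congrArg Subtype.val hm1)
  rw [hpow m] at h1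
  have hc : ((m + 1 : ℕ) * μ ^ m : K) ≠ 0 :=
    mul_ne_zero (Nat.cast_ne_zero.2 (Nat.succ_ne_zero m)) (pow_ne_zero _ hμ)
  have h2 : N = (((m + 1 : ℕ) * μ ^ m : K)⁻¹ * (1 - μ ^ (m + 1))) • 1 := by
    rw [mul_smul, eq_inv_smul_iff₀ hc, sub_smul, one_smul]
    exact eq_sub_of_add_eq' h1
  rw [h2, ← add_smul] at hAN
  exact hA (coe_eq_one_of_eq_smul_one hAN)

/-- A nontrivial Möbius map of finite order has exactly two fixed points. -/
theorem ncard_fixedBy_eq_two [IsAlgClosed K] [CharZero K]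
    {g : ProjectiveSpecialLinearGroup (Fin 2) K} (hg : g ≠ 1) (hfin : IsOfFinOrder g) :
    (fixedBy (Projectivization K (Fin 2 → K)) g).ncard = 2 := by
  obtain ⟨A, rfl⟩ := QuotientGroup.mk_surjective g
  obtain ⟨μ, ν, hsum, hprod⟩ := exists_eigenvalues A
  have hne := eigenvalues_ne (isOfFinOrder_of_coe hfin) hg hsum hprod
  obtain ⟨v, hv, hAv⟩ := exists_eigenvector hsum hprod hg
  obtain ⟨w, hw, hAw⟩ := exists_eigenvector (add_comm μ ν ▸ hsum) (mul_comm μ ν ▸ hprod) hg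
  have hvw : Projectivization.mk K v hv ≠ Projectivization.mk K w hw := by
    rw [Ne, Projectivization.mk_eq_mk_iff']
    rintro ⟨a, rfl⟩
    rw [mulVec_smul, hAw, smul_comm, ← sub_eq_zero, ← sub_smul, smul_eq_zero, sub_eq_zero] at hAv
    exact hAv.elim (fun h => hne h.symm) hv
  -- `A` preserves the determinant of `x` and `y` but also multiplies it by `a * b`.
  have hcross : ∀ x y : Fin 2 → K, ∀ a b : K, A.1 *ᵥ x = a • x → A.1 *ᵥ y = b • y →
      a * b ≠ 1 → x 0 * y 1 = x 1 * y 0 := by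
    intro x y a b hx hy hab
    have hdet := det_eq_one_fin_two A
    have hx0 := congrFun hx 0
    have hx1 := congrFun hx 1
    have hy0 := congrFun hy 0
    have hy1 := congrFun hy 1
    simp only [mulVec, dotProduct, Fin.sum_univ_two, Pi.smul_apply, smul_eq_mul] at hx0 hx1 hy0 hy1
    have key : (a * b - 1) * (x 0 * y 1 - x 1 * y 0) = 0 := by
      have e : (a * x 0) * (b * y 1) - (a * x 1) * (b * y 0) = x 0 * y 1 - x 1 * y 0 := by
        rw [← hx0, ← hx1, ← hy0, ← hy1]
        linear_combination (x 0 * y 1 - x 1 * y 0) * hdet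
      linear_combination e
    exact sub_eq_zero.1 ((mul_eq_zero.1 key).resolve_left (sub_ne_zero.2 hab))
  have hset : fixedBy (Projectivization K (Fin 2 → K))
      (A : ProjectiveSpecialLinearGroup (Fin 2) K) =
      {Projectivization.mk K v hv, Projectivization.mk K w hw} := by
    ext x
    rw [mem_fixedBy, Set.mem_insert_iff, Set.mem_singleton_iff]
    constructor
    · induction x using Projectivization.ind with | _ x hx =>
      intro h
      obtain ⟨a, ha⟩ := (psl_smul_mk_eq_iff A hx hx).1 h
      rw [mk_eq_mk_iff_cross, mk_eq_mk_iff_cross]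
      by_cases h1 : a * μ = 1
      · refine Or.inr (hcross x w a ν ha.symm hAw fun h2 => hne ?_)
        exact mul_left_cancel₀ (left_ne_zero_of_mul_eq_one h1) (h1.trans h2.symm)
      · exact Or.inl (hcross x v a μ ha.symm hAv h1)
    · rintro (rfl | rfl)
      · exact (psl_smul_mk_eq_iff A hv hv).2 ⟨μ, hAv.symm⟩
      · exact (psl_smul_mk_eq_iff A hw hw).2 ⟨ν, hAw.symm⟩
  rw [hset, Set.ncard_pair hvw]

end FixedPoints

/-- A finitely generated torsion subgroup of `PSL(n, K)` is finite if `K` has characteristic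
zero. -/
theorem finite_closure_of_isOfFinOrder_psl {n K : Type*} [Fintype n] [DecidableEq n] [Nonempty n]
    [Field K] [CharZero K] {S : Set (ProjectiveSpecialLinearGroup n K)} (hS : S.Finite)
    (htor : ∀ g ∈ Subgroup.closure S, IsOfFinOrder g) : Finite (Subgroup.closure S) := by
  let π := QuotientGroup.mk' (Subgroup.center (Matrix.SpecialLinearGroup n K))
  let T : Set (Matrix.SpecialLinearGroup n K) := Quotient.out '' S
  have hT : π '' T = S := by
    rw [← Set.image_comp]
    exact (Set.image_congr fun g _ => QuotientGroup.out_eq' g).trans (Set.image_id S)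
  have hmap : (Subgroup.closure T).map π = Subgroup.closure S := by
    rw [MonoidHom.map_closure, hT]
  have hfin : Finite (Subgroup.closure T) := by
    refine finite_closure_of_isOfFinOrder (hS.image _) fun g hg => isOfFinOrder_of_coe (htor _ ?_)
    rw [← hmap]
    exact Subgroup.mem_map_of_mem π hg
  rw [← hmap]
  exact Set.Finite.image π hfin

variable {p : ℕ} [Fact p.Prime]

/-! ### Good reduction of finite groups -/

theorem mem_padicComplexInt_iff {x : ℂ_[p]} : x ∈ 𝓞_ℂ_[p] ↔ ‖x‖ ≤ 1 := by
  rw [PadicComplex.norm_eq_norm]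
  exact (Valued.toNormedField.norm_le_one_iff (L := ℂ_[p]) (x := x)).symm

theorem hasGoodReduction_coe {B : Matrix.SpecialLinearGroup (Fin 2) ℂ_[p]} (hB : ∀ i j, ‖B.1 i j‖ ≤ 1) :
    HasGoodReduction (B : PSL2 p) := by
  let M : Matrix (Fin 2) (Fin 2) 𝓞_ℂ_[p] :=
    Matrix.of fun i j => ⟨B.1 i j, mem_padicComplexInt_iff.2 (hB i j)⟩
  have hMB : M.map (fun a => (a : ℂ_[p])) = B.1 := by
    ext i j
    rfl
  have hMdet : M.det = 1 := by
    apply Subtype.ext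
    have := det_eq_one_fin_two B
    rw [det_fin_two]
    exact this
  refine ⟨M, ?_, ?_, ?_⟩
  · intro v hv
    rw [hMB]
    have hBv : B.1 *ᵥ v ≠ 0 := fun h =>
      hv (eq_zero_of_mulVec_eq_zero (by rw [B.2]; exact one_ne_zero) h)
    exact ⟨hBv, (psl_smul_mk_eq_iff B hv hBv).2 ⟨1, one_smul _ _⟩⟩
  · by_contra! h
    have hlt : ∀ i j, ‖B.1 i j‖ < 1 := fun i j => lt_of_le_of_ne (hB i j) (h i j)
    have hmul : ∀ i j k l, ‖B.1 i j * B.1 k l‖ < 1 := fun i j k l => by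
      rw [norm_mul]
      exact mul_lt_one_of_nonneg_of_lt_one_left (norm_nonneg _) (hlt i j) (hB k l)
    have h1 := IsUltrametricDist.norm_add_le_max (B.1 0 0 * B.1 1 1) (-(B.1 0 1 * B.1 1 0))
    rw [← sub_eq_add_neg, det_eq_one_fin_two, norm_one, norm_neg] at h1
    exact absurd h1 (not_le.2 (max_lt (hmul _ _ _ _) (hmul _ _ _ _)))
  · intro v hv
    refine eq_zero_of_mulVec_eq_zero ?_ hv
    have := RingHom.map_det (IsLocalRing.residue 𝓞_ℂ_[p]) M
    rw [hMdet, map_one] at this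
    rw [← RingHom.mapMatrix_apply, ← this]
    exact one_ne_zero

/-- A finite group of Möbius maps has potentially good reduction: among the images of the standard
basis vectors under its elements, two whose determinant is largest span an invariant lattice. -/
theorem hasPotentiallyGoodReduction_of_finite (G : Subgroup (PSL2 p)) [Finite G] :
    HasPotentiallyGoodReduction G := by
  let cr : (Fin 2 → ℂ_[p]) → (Fin 2 → ℂ_[p]) → ℂ_[p] := fun v w => v 0 * w 1 - v 1 * w 0
  let lift : PSL2 p → Matrix.SpecialLinearGroup (Fin 2) ℂ_[p] := Quotient.out
  have hlift : ∀ g : PSL2 p, (lift g : PSL2 p) = g := fun g => QuotientGroup.out_eq' g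
  let s : G × Fin 2 → Fin 2 → ℂ_[p] := fun x => (lift x.1).1.col x.2
  -- By Cramer's rule, maximality makes the coordinates of every `s z` in the basis `s x`, `s y`
  -- integral.
  obtain ⟨⟨x, y⟩, hmax⟩ :=
    Finite.exists_max fun xy : (G × Fin 2) × (G × Fin 2) => ‖cr (s xy.1) (s xy.2)‖
  have hD : cr (s x) (s y) ≠ 0 := by
    have h1 := hmax ((1, 0), (1, 1))
    have h2 : cr (s (1, 0)) (s (1, 1)) = 1 := by
      have := det_eq_one_fin_two (lift (1 : G))
      simp only [cr, s, col_apply]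
      linear_combination this
    rw [h2, norm_one] at h1
    exact norm_pos_iff.1 (zero_lt_one.trans_le h1)
  -- Lifts to `SL` are multiplicative only up to a central scalar, which is a root of unity and so
  -- has norm 1.
  have hinv : ∀ A : Matrix.SpecialLinearGroup (Fin 2) ℂ_[p], (A : PSL2 p) ∈ G → ∀ z : G × Fin 2,
      ∃ (r : ℂ_[p]) (z' : G × Fin 2), ‖r‖ = 1 ∧ A.1 *ᵥ s z = r • s z' := by
    intro A hA z
    let g : G := ⟨A, hA⟩ * z.1
    have h1 : ((lift g : Matrix.SpecialLinearGroup (Fin 2) ℂ_[p]) : PSL2 p) =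
        ((A * lift z.1 : Matrix.SpecialLinearGroup (Fin 2) ℂ_[p]) : PSL2 p) := by
      rw [hlift, QuotientGroup.mk_mul, hlift]
      rfl
    obtain ⟨r, hr, hrA⟩ := Matrix.SpecialLinearGroup.mem_center_iff.1 (QuotientGroup.eq.1 h1)
    refine ⟨r, (g, z.2), ?_, ?_⟩
    · have := congrArg norm hr
      rw [norm_pow, norm_one] at this
      exact (pow_eq_one_iff_of_nonneg (norm_nonneg r) (by simp)).1 this
    · have h2 : (A * lift z.1).1 = r • (lift g).1 := by
        have h3 : A * lift z.1 = lift g * ((lift g)⁻¹ * (A * lift z.1)) := by group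
        rw [h3, Matrix.SpecialLinearGroup.coe_mul (lift g), ← hrA]
        ext i j
        simp [mul_comm]
      ext i
      have h4 := congrFun (congrFun h2 i) z.2
      rw [Matrix.SpecialLinearGroup.coe_mul, Matrix.mul_apply] at h4
      exact h4
  have hbound : ∀ A : Matrix.SpecialLinearGroup (Fin 2) ℂ_[p], (A : PSL2 p) ∈ G → ∀ z z' : G × Fin 2,
      ‖cr (A.1 *ᵥ s z) (s z') / cr (s x) (s y)‖ ≤ 1 := by
    intro A hA z z'
    obtain ⟨r, t, hr, ht⟩ := hinv A hA z
    have h1 : cr (A.1 *ᵥ s z) (s z') = r * cr (s t) (s z') := by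
      rw [ht]
      simp only [cr, Pi.smul_apply, smul_eq_mul]
      ring
    rw [h1, norm_div, norm_mul, hr, one_mul]
    exact div_le_one_of_le₀ (hmax (t, z')) (norm_nonneg _)
  -- Dividing the basis by a square root of its determinant puts the change of basis in `SL`.
  obtain ⟨c, hc⟩ := IsAlgClosed.exists_pow_nat_eq (cr (s x) (s y)) (n := 2) two_pos
  have hc0 : c ≠ 0 := by
    rintro rfl
    exact hD (by rw [← hc]; simp)
  let h : Matrix.SpecialLinearGroup (Fin 2) ℂ_[p] :=
    ⟨!![s x 0 / c, s y 0 / c; s x 1 / c, s y 1 / c], by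
      rw [det_fin_two_of]
      field_simp
      rw [hc]
      simp only [cr]
      ring⟩
  refine ⟨(h : PSL2 p), fun g hg => ?_⟩
  obtain ⟨A, rfl⟩ := QuotientGroup.mk_surjective g
  change HasGoodReduction ((h⁻¹ * A * h : Matrix.SpecialLinearGroup (Fin 2) ℂ_[p]) : PSL2 p)
  refine hasGoodReduction_coe fun i j => ?_
  have hent : (h⁻¹ * A * h).1 =
      !![cr (A.1 *ᵥ s x) (s y) / cr (s x) (s y), cr (A.1 *ᵥ s y) (s y) / cr (s x) (s y);
        -(cr (A.1 *ᵥ s x) (s x) / cr (s x) (s y)), -(cr (A.1 *ᵥ s y) (s x) / cr (s x) (s y))] := by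
    rw [Matrix.SpecialLinearGroup.coe_mul, Matrix.SpecialLinearGroup.coe_mul, Matrix.SpecialLinearGroup.coe_inv,
      ← hc]
    simp only [h, adjugate_fin_two_of]
    ext i j
    fin_cases i <;> fin_cases j <;>
      simp [Matrix.mul_apply, Fin.sum_univ_two, cr, vecMul, dotProduct] <;> field_simp <;> ring
  rw [hent]
  fin_cases i <;> fin_cases j
  · exact hbound A hg x y
  · exact hbound A hg y y
  · exact (norm_neg _).trans_le (hbound A hg x x)
  · exact (norm_neg _).trans_le (hbound A hg y x)

/-! ### From an empty limit set to finiteness -/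

theorem finite_stabilizer_of_limitSet_eq_empty {G : Subgroup (PSL2 p)} (hG : limitSet G = ∅)
    (b : P1 p) : Finite (stabilizer G b) := by
  by_contra hinf
  have : Infinite (stabilizer G b) := not_finite_iff_infinite.1 hinf
  let g : ℕ ↪ stabilizer G b := Infinite.natEmbedding _
  have hb : b ∈ limitSet G := by
    refine ⟨b, fun n => (g n).1.1, fun n => (g n).1.2, fun m n hmn =>
      g.injective (Subtype.ext (Subtype.ext hmn)), ?_⟩
    have hfix : ∀ n, ((g n).1.1 : PSL2 p) • b = b := fun n => (g n).2
    simp only [hfix, chordalDist_self]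
    exact tendsto_const_nhds
  rw [hG] at hb
  exact hb

/-- Any fixed point of `g` places it in a finite stabilizer. -/
theorem isOfFinOrder_of_limitSet_eq_empty {G : Subgroup (PSL2 p)} (hG : limitSet G = ∅) (g : G) :
    IsOfFinOrder g := by
  obtain ⟨b, hb⟩ := exists_smul_eq_self (g : PSL2 p)
  have := finite_stabilizer_of_limitSet_eq_empty hG b
  have h := isOfFinOrder_of_finite (⟨g, hb⟩ : stabilizer G b)
  exact (stabilizer G b).subtype.isOfFinOrder h

theorem finite_of_limitSet_eq_empty {G : Subgroup (PSL2 p)} (hG : limitSet G = ∅) : Finite G := by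
  have htor : ∀ g ∈ G, IsOfFinOrder g := fun g hg =>
    G.subtype.isOfFinOrder (isOfFinOrder_of_limitSet_eq_empty hG ⟨g, hg⟩)
  refine finite_of_locallyFinite_of_fixedBy (X := P1 p) (fun g hg => ?_)
    (finite_stabilizer_of_limitSet_eq_empty hG) fun S hS => ?_
  · exact ncard_fixedBy_eq_two (g := (g : PSL2 p)) (fun h => hg (Subtype.ext h)) (htor g g.2)
  · have hle : Subgroup.closure (G.subtype '' S) ≤ G := by
      rw [Subgroup.closure_le]
      rintro _ ⟨g, -, rfl⟩
      exact g.2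
    have hfin := finite_closure_of_isOfFinOrder_psl (hS.image G.subtype) fun g hg =>
      htor g (hle hg)
    rw [← MonoidHom.map_closure] at hfin
    exact Set.Finite.of_finite_image hfin G.subtype_injective.injOn

end PadicMobius

theorem theorem3 (p : ℕ) [Fact p.Prime] (G : Subgroup (PadicMobius.PSL2 p))
    (hG : PadicMobius.limitSet G = ∅) :
    PadicMobius.HasPotentiallyGoodReduction G := by
  have := PadicMobius.finite_of_limitSet_eq_empty hG
  exact PadicMobius.hasPotentiallyGoodReduction_of_finite G
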